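/- An \emph{addition chain} for a positive integer $n$ is a finite sequence $(a_0,a_1,\ldots,a_r)$ of positive integers with $a_0=1$, $a_r=n$, such that for every $1\le k\le r$ there exist $0\le i,j<k$ with $a_k=a_i+a_j$; $r$ is its length. For a set $A$ of addition chains let $\ell^A(n)$ be the shortest length of a chain in $A$ for $n$. Call $A$ \emph{admissible} if for every positive integer $n$ (1) there is a chain in $A$ for $n$ of length at most $\lfloor\log_2 n\rfloor+\nu_2(n)-1$, where $\nu_2(n)$ is the number of $1$'s in the binary expansion of $n$, and (2) $\ell^A(2n)\le \ell^A(n)+1$. For admissible $A$ put $\delta^A(n)=\ell^A(n)-\log_2 n$ and $\mathscr{D}^A=\{\delta^A(n): n\ge 1\}$. A positive integer $m$ is \emph{$A$-stable} if $\ell^A(2^k m)=k+\ell^A(m)$ for all $k\ge 0$; an \emph{$A$-stable defect} is the defect $\delta^A(m)$ of an $A$-stable number $m$, and $\mathscr{D}^A_{st}$ is the set of all $A$-stable defects. \textbf{Theorem.} Let $A$ be any admissible set of addition chains. Then $\mathscr{D}^A\cap[0,2]$ is a well-ordered subset of $\mathbb{R}$ of order type $\omega^2$, while for every real $r<2$ the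 set $\mathscr{D}^A\cap[0,r]$ is well-ordered with order type strictly less than $\omega^2$. Furthermore, all defects in $\mathscr{D}^A\cap[0,2]$ are $A$-stable defects, and so $\mathscr{D}^A_{st}\cap[0,2]$ is well-ordered with order type $\omega^2$. -/

import Mathlib

open scoped Ordinal

noncomputable section

/-- An addition chain `(a₀, …, a_r)` of length `r`. -/
structure AdditionChain where
  length : ℕ
  seq : Fin (length + 1) → ℕ
  seq_zero : seq 0 = 1
  seq_add : ∀ k : Fin (length + 1), 0 < k → ∃ i j, i < k ∧ j < k ∧ seq k = seq i + seq j

namespace AdditionChain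

/-- The number `n = a_r` that the chain is a chain for. -/
def target (c : AdditionChain) : ℕ := c.seq (Fin.last c.length)

/-- The number `ν₂(n)` of `1`'s in the binary expansion of `n`. -/
def nu2 (n : ℕ) : ℕ := (Nat.digits 2 n).count 1

/-- `ℓ^A(n)`: the shortest length of a chain in `A` for `n` (junk value `0` if there is none). -/
def len (A : Set AdditionChain) (n : ℕ) : ℕ :=
  sInf {r | ∃ c ∈ A, c.target = n ∧ c.length = r}

/-- Admissible sets of addition chains. For `n ≥ 1` one has `ν₂(n) ≥ 1`, so the natural-number
subtraction in the first field does not truncate. -/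
structure Admissible (A : Set AdditionChain) : Prop where
  exists_short : ∀ n : ℕ, 1 ≤ n →
    ∃ c ∈ A, c.target = n ∧ c.length ≤ Nat.log 2 n + nu2 n - 1
  len_two_mul_le : ∀ n : ℕ, 1 ≤ n → len A (2 * n) ≤ len A n + 1

/-- The `A`-defect `δ^A(n) = ℓ^A(n) - log₂ n`. -/
def defect (A : Set AdditionChain) (n : ℕ) : ℝ := (len A n : ℝ) - Real.logb 2 (n : ℝ)

/-- `A`-stable numbers. -/
def IsStable (A : Set AdditionChain) (m : ℕ) : Prop :=
  ∀ k : ℕ, len A (2 ^ k * m) = k + len A m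

/-- `𝒟^A`, the set of all `A`-defects of positive integers. -/
def defects (A : Set AdditionChain) : Set ℝ := {α | ∃ n : ℕ, 1 ≤ n ∧ defect A n = α}

/-- `α` is an `A`-stable defect: it is the defect of an `A`-stable positive integer. -/
def IsStableDefect (A : Set AdditionChain) (α : ℝ) : Prop :=
  ∃ n : ℕ, 1 ≤ n ∧ IsStable A n ∧ defect A n = α

/-- `𝒟^A_st`, the set of all `A`-stable defects. -/
def stableDefects (A : Set AdditionChain) : Set ℝ := {α | IsStableDefect A α}

end AdditionChain

/-- The set `S` of real numbers is well-ordered by `<`, with order type `o`. -/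
def HasOrderType (S : Set ℝ) (o : Ordinal.{0}) : Prop :=
  ∃ _ : IsWellOrder S (fun x y => x < y), Ordinal.type (fun x y : S => x < y) = o

end

/-! Write `len A n = ⌊log₂ n⌋ + s` and n = 2^⌊log₂ n⌋ · μ with 1 ≤ μ < 2. The defect is s - log₂ μ,
so a defect at most 2 forces s ≤ 2. A number with s ≤ 1 has at most s + 1 binary ones
(`Admissible.nu2_le_of_len_le`), while admissibility gives s ≤ ν₂(n) - 1. Hence doubling cannot
lower s when s ≤ 2, which is stability, and the values with s ≤ 1 are explicit.

For s = 2, a chain has boundedly many non-doublings, so a long chain contains a long run of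
doublings to which nothing outside refers. Cutting there (`IncreasingChain.exists_split`) gives n =
2^G · m + b with b relatively small, and m loses a small step unless b = 0. So mantissas accumulate
from above only at 1 and 1 + 2^(-k) (`finite_mantissa`), and defects below 2 only from below at the
points `cut i`, which increase to 2. This bounds the order type by ω², and by a finite multiple of ω
below any r < 2. Numbers with three binary ones supply a lexicographically increasing ℕ × ℕ grid of
defects (`defect_three_ones`), hence ω² is attained. -/

/-! ### Chain sets with at most one small step -/

/-- A finite set of positive integers containing `1` in which every other element is a sum of two
elements: the underlying set of an addition chain. -/
structure IsChainSet (S : Finset ℕ) : Prop where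
  one_mem : 1 ∈ S
  pos : ∀ x ∈ S, 0 < x
  eq_add : ∀ x ∈ S, x = 1 ∨ ∃ y ∈ S, ∃ z ∈ S, x = y + z

namespace IsChainSet

variable {S : Finset ℕ} {x y n : ℕ}

lemma filter_le (hS : IsChainSet S) (hn : 1 ≤ n) : IsChainSet {x ∈ S | x ≤ n} where
  one_mem := by simp [hS.one_mem, hn]
  pos x hx := hS.pos x (Finset.mem_filter.1 hx).1
  eq_add x hx := by
    obtain ⟨hx, hxn⟩ := Finset.mem_filter.1 hx
    refine (hS.eq_add x hx).imp_right ?_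
    rintro ⟨y, hy, z, hz, rfl⟩
    exact ⟨y, Finset.mem_filter.2 ⟨hy, by omega⟩, z, Finset.mem_filter.2 ⟨hz, by omega⟩, rfl⟩

lemma exists_le_add (hS : IsChainSet S) (hx : x ∈ S) (h1 : x ≠ 1) :
    ∃ y ∈ S, ∃ z ∈ S, x = y + z ∧ z ≤ y ∧ y < x ∧ z < x := by
  obtain ⟨y, hy, z, hz, rfl⟩ := (hS.eq_add x hx).resolve_left h1
  have := hS.pos y hy
  have := hS.pos z hz
  rcases le_total z y with h | h
  · exact ⟨y, hy, z, hz, rfl, h, by omega, by omega⟩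
  · exact ⟨z, hz, y, hy, add_comm _ _, h, by omega, by omega⟩

/-- Every dyadic interval below an element of a chain set meets the chain set. -/
lemma exists_log_eq (hS : IsChainSet S) : ∀ x ∈ S, ∀ e ≤ Nat.log 2 x,
    ∃ y ∈ S, y ≤ x ∧ Nat.log 2 y = e := by
  intro x
  induction x using Nat.strong_induction_on with
  | _ x ih =>
    intro hx e he
    rcases eq_or_lt_of_le he with rfl | he
    · exact ⟨x, hx, le_rfl, rfl⟩
    have h1 : x ≠ 1 := by rintro rfl; simp at he
    obtain ⟨y, hy, z, hz, hyz, hle, hlt, -⟩ := hS.exists_le_add hx h1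
    have hyl : e ≤ Nat.log 2 y := by
      have hy0 := hS.pos y hy
      have : Nat.log 2 x ≤ Nat.log 2 (y * 2) := Nat.log_mono_right (by omega)
      rw [Nat.log_mul_base (by norm_num) hy0.ne'] at this
      omega
    obtain ⟨w, hw, hwy, hwe⟩ := ih y hlt hy e hyl
    exact ⟨w, hw, by omega, hwe⟩

/-- The elements of `S` that are not the least ones in their dyadic intervals. -/
def nonminimal (S : Finset ℕ) : Finset ℕ := {x ∈ S | ∃ y ∈ S, y < x ∧ Nat.log 2 y = Nat.log 2 x}

lemma mem_nonminimal : x ∈ nonminimal S ↔ x ∈ S ∧ ∃ y ∈ S, y < x ∧ Nat.log 2 y = Nat.log 2 x := by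
  simp [nonminimal]

/-- Each of the ⌊log₂ n⌋ + 1 dyadic intervals up to n contributes its least element, so the
nonminimal elements are bounded by the number of small steps. -/
lemma log_add_card_nonminimal_lt (hS : IsChainSet S) (hn : n ∈ S) :
    Nat.log 2 n + (nonminimal S).card < S.card := by
  have hsub : nonminimal S ⊆ S := Finset.filter_subset _ _
  have h : Finset.range (Nat.log 2 n + 1) ⊆ (S \ nonminimal S).image (Nat.log 2) := by
    intro e he
    obtain ⟨y, hy, -, hye⟩ := hS.exists_log_eq n hn e (by simpa [Nat.lt_succ_iff] using he)
    have hex : ∃ y, y ∈ S ∧ Nat.log 2 y = e := ⟨y, hy, hye⟩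
    classical
    obtain ⟨hm, hme⟩ := Nat.find_spec hex
    refine Finset.mem_image.2 ⟨Nat.find hex, Finset.mem_sdiff.2 ⟨hm, ?_⟩, hme⟩
    rw [mem_nonminimal]
    rintro ⟨-, z, hz, hlt, hlog⟩
    exact Nat.find_min hex hlt ⟨hz, hlog.trans hme⟩
  have h1 := (Finset.card_le_card h).trans Finset.card_image_le
  rw [Finset.card_range, Finset.card_sdiff_of_subset hsub] at h1
  have := Finset.card_le_card hsub
  omega

lemma log_lt_card (hS : IsChainSet S) (hn : n ∈ S) : Nat.log 2 n < S.card :=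
  lt_of_le_of_lt (Nat.le_add_right _ _) (hS.log_add_card_nonminimal_lt hn)

/-- If the elements up to `x` are all the least ones in their dyadic intervals, then they are
powers of two. -/
lemma eq_two_pow (hS : IsChainSet S) : ∀ x ∈ S, (∀ y ∈ S, y ≤ x → y ∉ nonminimal S) →
    x = 2 ^ Nat.log 2 x := by
  intro x
  induction x using Nat.strong_induction_on with
  | _ x ih =>
    intro hx hmin
    by_cases h1 : x = 1
    · simp [h1]
    obtain ⟨y, hy, z, hz, hyz, hle, hyx, hzx⟩ := hS.exists_le_add hx h1
    have key : ∀ w ∈ S, w < x → ∃ i < Nat.log 2 x, w = 2 ^ i := fun w hw hwx => by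
      refine ⟨Nat.log 2 w, lt_of_le_of_ne (Nat.log_mono_right hwx.le) fun h => ?_,
        ih w hwx hw fun v hv hvw => hmin v hv (hvw.trans hwx.le)⟩
      exact hmin x hx le_rfl (mem_nonminimal.2 ⟨hx, w, hw, hwx, h⟩)
    obtain ⟨i, hi, rfl⟩ := key y hy hyx
    obtain ⟨j, hj, rfl⟩ := key z hz hzx
    -- Both summands are powers of two below 2^⌊log₂ x⌋ and their sum reaches it, so both equal its
    -- half.
    have hlow : 2 ^ Nat.log 2 x ≤ x := Nat.pow_log_le_self 2 (by have := hS.pos x hx; omega)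
    obtain ⟨e, he⟩ : ∃ e, Nat.log 2 x = e + 1 := ⟨Nat.log 2 x - 1, by omega⟩
    have h2 : 2 ^ i ≤ 2 ^ e := Nat.pow_le_pow_right (by norm_num) (by omega)
    have h3 : 2 ^ j ≤ 2 ^ e := Nat.pow_le_pow_right (by norm_num) (by omega)
    rw [he, pow_succ] at hlow ⊢
    omega

end IsChainSet

/-- Numbers with at most two ones in their binary expansions. -/
def IsTwoBit (x : ℕ) : Prop := (∃ e, x = 2 ^ e) ∨ ∃ e j, j < e ∧ x = 2 ^ e + 2 ^ j

lemma isTwoBit_pow_add_pow (i j : ℕ) : IsTwoBit (2 ^ i + 2 ^ j) := by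
  rcases lt_trichotomy i j with h | rfl | h
  · exact Or.inr ⟨j, i, h, add_comm _ _⟩
  · exact Or.inl ⟨i + 1, by ring⟩
  · exact Or.inr ⟨i, j, h, rfl⟩

lemma IsTwoBit.eq_log {x : ℕ} (h : IsTwoBit x) :
    x = 2 ^ Nat.log 2 x ∨ ∃ j < Nat.log 2 x, x = 2 ^ Nat.log 2 x + 2 ^ j := by
  rcases h with ⟨e, rfl⟩ | ⟨e, j, hj, rfl⟩
  · left; rw [Nat.log_pow (by norm_num)]
  · have hlt : 2 ^ j < 2 ^ e := Nat.pow_lt_pow_right (by norm_num) hj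
    have : Nat.log 2 (2 ^ e + 2 ^ j) = e :=
      Nat.log_eq_of_pow_le_of_lt_pow (Nat.le_add_right _ _) (by rw [pow_succ]; omega)
    right
    rw [this]
    exact ⟨j, hj, rfl⟩

/-- Below the only nonminimal element everything is a power of two, so that element is a sum of two
powers. Any other x > 1 opens its dyadic interval: its larger summand lies in the previous interval
and the sum must reach the next power of two, which leaves few binary patterns. -/
lemma IsChainSet.isTwoBit {S : Finset ℕ} (hS : IsChainSet S)
    (hcard : (IsChainSet.nonminimal S).card ≤ 1) : ∀ x ∈ S, IsTwoBit x := by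
  have huniq : ∀ x ∈ nonminimal S, ∀ y ∈ nonminimal S, x = y :=
    fun x hx y hy => Finset.card_le_one.1 hcard x hx y hy
  have hpow : ∀ x ∈ nonminimal S, ∀ w ∈ S, w < x → w = 2 ^ Nat.log 2 w := fun x hx w hw hwx =>
    hS.eq_two_pow w hw fun y _ hyw hyn => by have := huniq x hx y hyn; omega
  intro x
  induction x using Nat.strong_induction_on with
  | _ x ih =>
    intro hx
    by_cases h1 : x = 1
    · exact Or.inl ⟨0, h1⟩
    obtain ⟨y, hy, z, hz, hyz, hle, hyx, hzx⟩ := hS.exists_le_add hx h1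
    by_cases hxn : x ∈ nonminimal S
    · rw [hyz, hpow x hxn y hy hyx, hpow x hxn z hz hzx]
      exact isTwoBit_pow_add_pow _ _
    have hlog : ∀ w ∈ S, w < x → Nat.log 2 w < Nat.log 2 x := fun w hw hwx =>
      lt_of_le_of_ne (Nat.log_mono_right hwx.le) fun h =>
        hxn (mem_nonminimal.2 ⟨hx, w, hw, hwx, h⟩)
    have hylog := hlog y hy hyx
    have hzlog := hlog z hz hzx
    have hlow : 2 ^ Nat.log 2 x ≤ x := Nat.pow_log_le_self 2 (by omega)
    obtain ⟨e, he⟩ : ∃ e, Nat.log 2 x = e + 1 := ⟨Nat.log 2 x - 1, by omega⟩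
    have hye : Nat.log 2 y = e := by
      by_contra hne
      have h2 : y < 2 ^ e := Nat.lt_pow_of_log_lt (by norm_num) (by omega)
      rw [he, pow_succ] at hlow
      omega
    rw [he, pow_succ] at hlow
    rcases eq_or_lt_of_le hle with rfl | hzy
    · rcases ih z hzx hz with ⟨i, hi⟩ | ⟨i, j, hj, hi⟩
      · exact Or.inl ⟨i + 1, by rw [hyz, hi]; ring⟩
      · exact Or.inr ⟨i + 1, j + 1, by omega, by rw [hyz, hi]; ring⟩
    rcases (ih y hyx hy).eq_log with hy2 | ⟨j, hj, hy2⟩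
    · rw [hye] at hy2
      omega
    rw [hye] at hj hy2
    rcases (ih z hzx hz).eq_log with hz2 | ⟨i, hi, hz2⟩
    all_goals
      rcases eq_or_lt_of_le (show Nat.log 2 z ≤ e by omega) with hze | hze
    · exact Or.inr ⟨e + 1, j, by omega, by rw [hyz, hy2, hz2, hze]; ring⟩
    · obtain ⟨d, rfl⟩ : ∃ d, e = d + 1 := ⟨e - 1, by omega⟩
      have h2 : 2 ^ j ≤ 2 ^ d := Nat.pow_le_pow_right (by norm_num) (by omega)
      have h3 : 2 ^ Nat.log 2 z ≤ 2 ^ d := Nat.pow_le_pow_right (by norm_num) (by omega)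
      refine Or.inl ⟨d + 2, ?_⟩
      rw [pow_succ] at hlow hy2
      rw [pow_succ, pow_succ]
      omega
    -- Here y and z share an interval, so y is the nonminimal element and z < y would have to be a
    -- power of two.
    · have := hpow y (mem_nonminimal.2 ⟨hy, z, hz, hzy, by omega⟩) z hz hzy
      have := Nat.pow_pos (n := i) (show 0 < 2 by norm_num)
      omega
    · obtain ⟨d, rfl⟩ : ∃ d, e = d + 1 := ⟨e - 1, by omega⟩
      have h3 : 2 ^ Nat.log 2 z ≤ 2 ^ d := Nat.pow_le_pow_right (by norm_num) (by omega)
      rcases eq_or_lt_of_le (show j ≤ d by omega) with rfl | hjd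
      · have hzd : Nat.log 2 z = j := by
          by_contra hne
          have h4 : z < 2 ^ j := Nat.lt_pow_of_log_lt (by norm_num) (by omega)
          rw [pow_succ] at hlow hy2
          omega
        refine Or.inr ⟨j + 2, i, by omega, ?_⟩
        rw [hyz, hy2, hz2, hzd]
        ring
      -- Now y ≤ 5 · 2^c and z ≤ 3 · 2^c while y + z ≥ 8 · 2^c, so equality holds throughout.
      · obtain ⟨c, rfl⟩ : ∃ c, d = c + 1 := ⟨d - 1, by omega⟩
        have h4 : 2 ^ j ≤ 2 ^ c := Nat.pow_le_pow_right (by norm_num) (by omega)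
        have h5 : 2 ^ i ≤ 2 ^ c := Nat.pow_le_pow_right (by norm_num) (by omega)
        refine Or.inl ⟨c + 3, ?_⟩
        simp only [pow_succ] at hlow hy2 h3 ⊢
        omega

/-- `n` has a chain with at most `s` small steps. -/
def HasSmallSteps (s n : ℕ) : Prop :=
  ∃ S, IsChainSet S ∧ n ∈ S ∧ S.card ≤ Nat.log 2 n + 1 + s

lemma HasSmallSteps.isTwoBit {n : ℕ} (h : HasSmallSteps 1 n) : IsTwoBit n := by
  obtain ⟨S, hS, hn, hc⟩ := h
  have := hS.log_add_card_nonminimal_lt hn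
  exact hS.isTwoBit (by omega) n hn

lemma HasSmallSteps.eq_two_pow {n : ℕ} (h : HasSmallSteps 0 n) : ∃ e, n = 2 ^ e := by
  obtain ⟨S, hS, hn, hc⟩ := h
  have := hS.log_add_card_nonminimal_lt hn
  have h0 : IsChainSet.nonminimal S = ∅ := Finset.card_eq_zero.1 (by omega)
  exact ⟨_, hS.eq_two_pow n hn fun y _ _ => by simp [h0]⟩

/-! ### Binary weight and stability -/

namespace AdditionChain

lemma nu2_two_mul (n : ℕ) : nu2 (2 * n) = nu2 n := by
  rcases Nat.eq_zero_or_pos n with rfl | hn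
  · simp
  · rw [nu2, Nat.digits_def' (by norm_num) (by omega)]
    simp [nu2]

lemma nu2_two_mul_add_one (n : ℕ) : nu2 (2 * n + 1) = nu2 n + 1 := by
  rw [nu2, Nat.digits_def' (by norm_num) (by omega)]
  have h1 : (2 * n + 1) % 2 = 1 := by omega
  have h2 : (2 * n + 1) / 2 = n := by omega
  simp [nu2, h1, h2]

lemma nu2_two_pow_mul (k n : ℕ) : nu2 (2 ^ k * n) = nu2 n := by
  induction k with
  | zero => simp
  | succ k ih => rw [pow_succ', mul_assoc, nu2_two_mul, ih]

lemma nu2_two_pow_add {a : ℕ} : ∀ {m : ℕ}, m < 2 ^ a → nu2 (2 ^ a + m) = nu2 m + 1 := by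
  induction a with
  | zero =>
    intro m hm
    obtain rfl : m = 0 := by simpa using hm
    simp [nu2]
  | succ a ih =>
    intro m hm
    rw [pow_succ] at hm ⊢
    obtain ⟨k, rfl | rfl⟩ : ∃ k, m = 2 * k ∨ m = 2 * k + 1 := ⟨m / 2, by omega⟩
    · rw [show 2 ^ a * 2 + 2 * k = 2 * (2 ^ a + k) by ring, nu2_two_mul, nu2_two_mul,
        ih (by omega)]
    · rw [show 2 ^ a * 2 + (2 * k + 1) = 2 * (2 ^ a + k) + 1 by ring, nu2_two_mul_add_one,
        nu2_two_mul_add_one, ih (by omega)]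

lemma nu2_two_pow (a : ℕ) : nu2 (2 ^ a) = 1 := by
  simpa [nu2] using nu2_two_pow_add (a := a) (m := 0) (by positivity)

lemma nu2_le_two_of_isTwoBit {n : ℕ} (h : IsTwoBit n) : nu2 n ≤ 2 := by
  rcases h with ⟨e, rfl⟩ | ⟨e, j, hj, rfl⟩
  · rw [nu2_two_pow]
    norm_num
  · rw [nu2_two_pow_add (Nat.pow_lt_pow_right (by norm_num) hj), nu2_two_pow]

/-- The terms of an addition chain form a chain set containing its target. -/
lemma exists_isChainSet (c : AdditionChain) :
    ∃ S, IsChainSet S ∧ c.target ∈ S ∧ S.card ≤ c.length + 1 := by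
  refine ⟨Finset.univ.image c.seq, ⟨?_, ?_, ?_⟩, ?_, ?_⟩
  · exact Finset.mem_image.2 ⟨0, Finset.mem_univ _, c.seq_zero⟩
  · intro x hx
    obtain ⟨k, -, rfl⟩ := Finset.mem_image.1 hx
    induction k using WellFoundedLT.induction with
    | _ k ih =>
      rcases eq_or_ne k 0 with rfl | hk
      · rw [c.seq_zero]
        norm_num
      · obtain ⟨i, j, hi, hj, hij⟩ := c.seq_add k (Fin.pos_iff_ne_zero.2 hk)
        have := ih i hi (Finset.mem_image_of_mem _ (Finset.mem_univ _))
        omega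
  · intro x hx
    obtain ⟨k, -, rfl⟩ := Finset.mem_image.1 hx
    rcases eq_or_ne k 0 with rfl | hk
    · exact Or.inl c.seq_zero
    · obtain ⟨i, j, hi, hj, hij⟩ := c.seq_add k (Fin.pos_iff_ne_zero.2 hk)
      exact Or.inr ⟨_, Finset.mem_image_of_mem _ (Finset.mem_univ i), _,
        Finset.mem_image_of_mem _ (Finset.mem_univ j), hij⟩
  · exact Finset.mem_image_of_mem _ (Finset.mem_univ _)
  · exact Finset.card_image_le.trans (by simp)

namespace Admissible

variable {A : Set AdditionChain} {n : ℕ}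

lemma len_le (hA : Admissible A) (hn : 1 ≤ n) : len A n ≤ Nat.log 2 n + nu2 n - 1 := by
  obtain ⟨c, hc, hcn, hle⟩ := hA.exists_short n hn
  exact (Nat.sInf_le (s := {r | ∃ c ∈ A, c.target = n ∧ c.length = r})
    ⟨c, hc, hcn, rfl⟩).trans hle

lemma exists_isChainSet (hA : Admissible A) (hn : 1 ≤ n) :
    ∃ S, IsChainSet S ∧ n ∈ S ∧ S.card ≤ len A n + 1 := by
  obtain ⟨c, hc, hcn, -⟩ := hA.exists_short n hn
  obtain ⟨c, hc, rfl, hl⟩ := Nat.sInf_mem (s := {r | ∃ c ∈ A, c.target = n ∧ c.length = r})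
    ⟨c.length, c, hc, hcn, rfl⟩
  rw [len, ← hl]
  exact c.exists_isChainSet

lemma log_le_len (hA : Admissible A) (hn : 1 ≤ n) : Nat.log 2 n ≤ len A n := by
  obtain ⟨S, hS, hnS, hc⟩ := hA.exists_isChainSet hn
  have := hS.log_lt_card hnS
  omega

lemma hasSmallSteps (hA : Admissible A) (hn : 1 ≤ n) {s : ℕ} (h : len A n ≤ Nat.log 2 n + s) :
    HasSmallSteps s n := by
  obtain ⟨S, hS, hnS, hc⟩ := hA.exists_isChainSet hn
  exact ⟨S, hS, hnS, by omega⟩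

lemma nu2_le_of_len_le (hA : Admissible A) (hn : 1 ≤ n) {s : ℕ} (hs : s ≤ 1)
    (h : len A n ≤ Nat.log 2 n + s) : nu2 n ≤ s + 1 := by
  have hT := hA.hasSmallSteps hn h
  interval_cases s
  · obtain ⟨e, rfl⟩ := hT.eq_two_pow
    rw [nu2_two_pow]
  · exact nu2_le_two_of_isTwoBit hT.isTwoBit

/-- If some 2^k · n were shorter than expected, it would have s ≤ 1 small steps, so ν₂(n) = ν₂(2^k ·
n) ≤ s + 1. The binary bound for n then gives a length at most ⌊log₂ n⌋ + s, a contradiction. -/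
lemma isStable (hA : Admissible A) (hn : 1 ≤ n) (h : len A n ≤ Nat.log 2 n + 2) :
    IsStable A n := by
  intro k
  have hpow : ∀ k, Nat.log 2 (2 ^ k * n) = Nat.log 2 n + k := fun k => by
    induction k with
    | zero => simp
    | succ k ih =>
      have : 2 ^ k * n ≠ 0 := by positivity
      rw [pow_succ, mul_right_comm, Nat.log_mul_base (by norm_num) this, ih, add_assoc]
  have hk1 : 1 ≤ 2 ^ k * n := Nat.one_le_iff_ne_zero.2 (by positivity)
  apply le_antisymm
  · clear hk1
    induction k with
    | zero => simp
    | succ k ih =>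
      have := hA.len_two_mul_le (2 ^ k * n) (Nat.one_le_iff_ne_zero.2 (by positivity))
      rw [pow_succ', mul_assoc]
      omega
  · by_contra! hlt
    have hlow := hA.log_le_len hk1
    rw [hpow] at hlow
    have hnu := hA.nu2_le_of_len_le hk1 (s := len A (2 ^ k * n) - Nat.log 2 n - k) (by omega)
      (by rw [hpow]; omega)
    rw [nu2_two_pow_mul] at hnu
    have := hA.len_le hn
    omega

end Admissible

end AdditionChain

/-! ### Splitting a chain along a run of doublings -/

/-- An increasing addition chain `a 0, …, a r`, together with a choice of summands. -/
structure IncreasingChain (r : ℕ) (a i j : ℕ → ℕ) : Prop where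
  zero : a 0 = 1
  lt : ∀ k l, k < l → l ≤ r → a k < a l
  left_lt : ∀ k, 1 ≤ k → k ≤ r → i k < k
  right_lt : ∀ k, 1 ≤ k → k ≤ r → j k < k
  eq_add : ∀ k, 1 ≤ k → k ≤ r → a k = a (i k) + a (j k)
  doubling : ∀ k, 1 ≤ k → k ≤ r → a k = 2 * a (k - 1) → i k = k - 1 ∧ j k = k - 1

lemma IsChainSet.exists_increasingChain {S : Finset ℕ} {n : ℕ} (hS : IsChainSet S) (hn : n ∈ S) :
    ∃ r a i j, IncreasingChain r a i j ∧ a r = n ∧ r + 1 ≤ S.card := by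
  classical
  have hn1 : 1 ≤ n := hS.pos n hn
  set T := {x ∈ S | x ≤ n} with hT
  have hTc : IsChainSet T := hS.filter_le hn1
  have hnT : n ∈ T := by simp [hT, hn]
  have hmax : ∀ x ∈ T, x ≤ n := fun x hx => (Finset.mem_filter.1 hx).2
  have hfin : (Set.ofPred (· ∈ T)).Finite := T.finite_toSet
  have hcard : ∀ hf : (Set.ofPred (· ∈ T)).Finite, hf.toFinset.card = T.card := fun hf => by
    rw [show hf.toFinset = T by ext; simp]
  have hpos : 0 < T.card := Finset.card_pos.2 ⟨n, hnT⟩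
  set a : ℕ → ℕ := Nat.nth (· ∈ T) with ha
  have hmem : ∀ k ≤ T.card - 1, a k ∈ T := fun k hk =>
    Nat.nth_mem_of_lt_card hfin (by rw [hcard]; omega)
  have hlt : ∀ k l, k < l → l ≤ T.card - 1 → a k < a l := fun k l hkl hl =>
    Nat.nth_lt_nth' hkl fun _ => by rw [hcard]; omega
  have hsurj : ∀ x ∈ T, ∃ k ≤ T.card - 1, a k = x := fun x hx => by
    obtain ⟨k, hk, hkx⟩ := Nat.exists_lt_card_finite_nth_eq hfin hx
    rw [hcard] at hk
    exact ⟨k, by omega, hkx⟩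
  have hlt' : ∀ k l, k ≤ T.card - 1 → l ≤ T.card - 1 → a k < a l → k < l := fun k l hk _ h => by
    by_contra! hle
    rcases eq_or_lt_of_le hle with rfl | hlk
    · exact lt_irrefl _ h
    · exact (h.trans (hlt l k hlk hk)).false
  have h0 : a 0 = 1 := by
    obtain ⟨k, hk, hk1⟩ := hsurj 1 hTc.one_mem
    rcases Nat.eq_zero_or_pos k with rfl | hk0
    · exact hk1
    · have := hlt 0 k hk0 hk
      have := hTc.pos _ (hmem 0 (by omega))
      omega
  have hr : a (T.card - 1) = n := by
    obtain ⟨k, hk, hkn⟩ := hsurj n hnT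
    rcases eq_or_lt_of_le hk with rfl | hk'
    · exact hkn
    · have := hlt _ _ hk' le_rfl
      have := hmax _ (hmem _ le_rfl)
      omega
  have hex : ∀ k, ∃ p q : ℕ, 1 ≤ k → k ≤ T.card - 1 →
      p < k ∧ q < k ∧ a k = a p + a q ∧ (a k = 2 * a (k - 1) → p = k - 1 ∧ q = k - 1) := by
    intro k
    by_cases hk : 1 ≤ k ∧ k ≤ T.card - 1
    · obtain ⟨hk1, hkr⟩ := hk
      by_cases hd : a k = 2 * a (k - 1)
      · exact ⟨k - 1, k - 1, fun _ _ => ⟨by omega, by omega, by omega, fun _ => ⟨rfl, rfl⟩⟩⟩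
      · have hne : a k ≠ 1 := by have := hlt 0 k hk1 hkr; omega
        obtain ⟨y, hy, z, hz, hyz, -, hyx, hzx⟩ := hTc.exists_le_add (hmem k hkr) hne
        obtain ⟨p, hp, rfl⟩ := hsurj y hy
        obtain ⟨q, hq, rfl⟩ := hsurj z hz
        exact ⟨p, q, fun _ _ => ⟨hlt' _ _ hp hkr hyx, hlt' _ _ hq hkr hzx, hyz,
          fun h => absurd h hd⟩⟩
    · exact ⟨0, 0, fun h1 h2 => absurd ⟨h1, h2⟩ hk⟩
  choose i j hij using hex
  refine ⟨T.card - 1, a, i, j, ⟨h0, hlt, fun k h1 h2 => (hij k h1 h2).1,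
    fun k h1 h2 => (hij k h1 h2).2.1, fun k h1 h2 => (hij k h1 h2).2.2.1,
    fun k h1 h2 => (hij k h1 h2).2.2.2⟩, hr, ?_⟩
  have hTS : T.card ≤ S.card := Finset.card_le_card (Finset.filter_subset _ _)
  omega

/-- The splitting of the elements of a chain along a run of doublings `a g, …, 2 ^ G * a g`: later
elements are `2 ^ G * (split k).1 + (split k).2`. -/
def chainSplit (a i j : ℕ → ℕ) (g G k : ℕ) : ℕ × ℕ :=
  -- The pair is meaningful at k ≤ g and k ≥ g + G; strictly inside the run it is a dummy, and the
  -- final 0 is not reached for later indices of an increasing chain.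
  if k ≤ g then (0, a k) else if k ≤ g + G then (a g, 0) else
    if _h : i k < k ∧ j k < k then chainSplit a i j g G (i k) + chainSplit a i j g G (j k) else 0
termination_by k
decreasing_by
  · exact _h.1
  · exact _h.2

namespace IncreasingChain

variable {r : ℕ} {a i j : ℕ → ℕ}

lemma le (h : IncreasingChain r a i j) {k l : ℕ} (hkl : k ≤ l) (hl : l ≤ r) : a k ≤ a l := by
  rcases eq_or_lt_of_le hkl with rfl | hlt
  · exact le_rfl
  · exact (h.lt k l hlt hl).le

lemma pos (h : IncreasingChain r a i j) {k : ℕ} (hk : k ≤ r) : 0 < a k := by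
  have := h.le (Nat.zero_le k) hk
  have := h.zero
  omega

lemma le_two_mul (h : IncreasingChain r a i j) {k : ℕ} (hk : k + 1 ≤ r) :
    a (k + 1) ≤ 2 * a k := by
  have h1 := h.left_lt (k + 1) (by omega) hk
  have h2 := h.right_lt (k + 1) (by omega) hk
  have h3 := h.eq_add (k + 1) (by omega) hk
  have h4 := h.le (k := i (k + 1)) (l := k) (by omega) (by omega)
  have h5 := h.le (k := j (k + 1)) (l := k) (by omega) (by omega)
  omega

lemma le_two_pow (h : IncreasingChain r a i j) {k : ℕ} (hk : k ≤ r) : a k ≤ 2 ^ k := by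
  induction k with
  | zero => simp [h.zero]
  | succ k ih =>
    have := h.le_two_mul hk
    have := ih (by omega)
    rw [pow_succ]
    omega

/-- A doubling run that is not referred to from outside splits the target of the chain. -/
lemma exists_split (h : IncreasingChain r a i j) {g G : ℕ} (hG : 1 ≤ G) (hgG : g + G ≤ r)
    (hrun : ∀ k, g < k → k ≤ g + G → a k = 2 * a (k - 1))
    (hi : ∀ k, g + G < k → k ≤ r → i k ≤ g ∨ g + G ≤ i k)
    (hj : ∀ k, g + G < k → k ≤ r → j k ≤ g ∨ g + G ≤ j k) :
    ∃ m b, a r = 2 ^ G * m + b ∧ b ≤ 2 ^ (r - G) ∧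
      ∃ S, IsChainSet S ∧ m ∈ S ∧ S.card ≤ r + 1 - G ∧ (b ≠ 0 → S.card ≤ r - G) := by
  classical
  set p := chainSplit a i j g G with hp
  have plow : ∀ k ≤ g, p k = (0, a k) := fun k hk => by rw [hp, chainSplit, if_pos hk]
  have pend : p (g + G) = (a g, 0) := by
    rw [hp, chainSplit, if_neg (by omega), if_pos le_rfl]
  have phigh : ∀ k, g + G < k → k ≤ r → p k = p (i k) + p (j k) := fun k hk hkr => by
    rw [hp, chainSplit, if_neg (by omega), if_neg (by omega),
      dif_pos ⟨h.left_lt k (by omega) hkr, h.right_lt k (by omega) hkr⟩]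
  have hpow : ∀ e ≤ G, a (g + e) = 2 ^ e * a g := fun e => by
    induction e with
    | zero => simp
    | succ e ih =>
      intro he
      rw [hrun (g + (e + 1)) (by omega) (by omega), show g + (e + 1) - 1 = g + e by omega,
        ih (by omega)]
      ring
  have hval : ∀ k, k ≤ r → (k ≤ g ∨ g + G ≤ k) → a k = 2 ^ G * (p k).1 + (p k).2 := by
    intro k
    induction k using Nat.strong_induction_on with
    | _ k ih =>
      rintro hkr (hk | hk)
      · simp [plow k hk]
      rcases eq_or_lt_of_le hk with rfl | hk
      · simp [pend, hpow G le_rfl]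
      have hik := h.left_lt k (by omega) hkr
      have hjk := h.right_lt k (by omega) hkr
      rw [h.eq_add k (by omega) hkr, phigh k hk hkr, ih _ hik (by omega) (hi k hk hkr),
        ih _ hjk (by omega) (hj k hk hkr), Prod.fst_add, Prod.snd_add]
      ring
  have hsnd : ∀ k, k ≤ r → g + G ≤ k → (p k).2 ≤ 2 ^ (k - G) := by
    intro k
    induction k using Nat.strong_induction_on with
    | _ k ih =>
      intro hkr hk
      rcases eq_or_lt_of_le hk with rfl | hk
      · simp [pend]
      have key : ∀ l < k, (l ≤ g ∨ g + G ≤ l) → (p l).2 ≤ 2 ^ (k - G - 1) := by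
        rintro l hl (hlg | hlg)
        · rw [plow l hlg]
          exact (h.le_two_pow (by omega)).trans (Nat.pow_le_pow_right (by norm_num) (by omega))
        · exact (ih l hl (by omega) hlg).trans (Nat.pow_le_pow_right (by norm_num) (by omega))
      have h1 := key _ (h.left_lt k (by omega) hkr) (hi k hk hkr)
      have h2 := key _ (h.right_lt k (by omega) hkr) (hj k hk hkr)
      rw [phigh k hk hkr, Prod.snd_add, show k - G = k - G - 1 + 1 by omega, pow_succ]
      omega
  -- Two summands from before the run give at most 2 · a g ≤ a (g + G), so a later element has a
  -- summand at or after the end of the run.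
  have hnot : ∀ k, g + G < k → k ≤ r → ¬ (i k ≤ g ∧ j k ≤ g) := by
    rintro k hk hkr ⟨hik, hjk⟩
    have h1 := h.le hik (by omega)
    have h2 := h.le hjk (by omega)
    have h3 := h.lt (g + G) k hk hkr
    rw [h.eq_add k (by omega) hkr, hpow G le_rfl] at h3
    have h4 : 2 ^ 1 ≤ 2 ^ G := Nat.pow_le_pow_right (by norm_num) hG
    have h5 : 2 ^ 1 * a g ≤ 2 ^ G * a g := Nat.mul_le_mul_right _ h4
    omega
  have hset : ∀ S : Finset ℕ, (∀ k ≤ g, a k ∈ S) → (∀ k, g + G ≤ k → k ≤ r → (p k).1 ∈ S) →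
      (∀ x ∈ S, (∃ k ≤ g, x = a k) ∨ ∃ k, g + G ≤ k ∧ k ≤ r ∧ x = (p k).1) → IsChainSet S := by
    intro S hlow hhigh hall
    have halow : ∀ k ≤ g, 0 < a k ∧ (a k = 1 ∨ ∃ y ∈ S, ∃ z ∈ S, a k = y + z) := by
      intro k hk
      refine ⟨h.pos (by omega), ?_⟩
      rcases Nat.eq_zero_or_pos k with rfl | hk0
      · exact Or.inl h.zero
      · have := h.left_lt k hk0 (by omega)
        have := h.right_lt k hk0 (by omega)
        exact Or.inr ⟨_, hlow (i k) (by omega), _, hlow (j k) (by omega),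
          h.eq_add k hk0 (by omega)⟩
    have hahigh : ∀ k, g + G ≤ k → k ≤ r →
        0 < (p k).1 ∧ ((p k).1 = 1 ∨ ∃ y ∈ S, ∃ z ∈ S, (p k).1 = y + z) := by
      intro k
      induction k using Nat.strong_induction_on with
      | _ k ih =>
        intro hk hkr
        rcases eq_or_lt_of_le hk with rfl | hk
        · rw [pend]
          exact halow g le_rfl
        have hik := h.left_lt k (by omega) hkr
        have hjk := h.right_lt k (by omega) hkr
        rw [phigh k hk hkr, Prod.fst_add]
        rcases hi k hk hkr with h1 | h1
        · have h2 := (hj k hk hkr).resolve_left fun h2 => hnot k hk hkr ⟨h1, h2⟩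
          rw [plow _ h1]
          simpa using ih _ hjk h2 (by omega)
        rcases hj k hk hkr with h2 | h2
        · rw [plow _ h2]
          simpa using ih _ hik h1 (by omega)
        · exact ⟨Nat.add_pos_left (ih _ hik h1 (by omega)).1 _,
            Or.inr ⟨_, hhigh _ h1 (by omega), _, hhigh _ h2 (by omega), rfl⟩⟩
    refine ⟨h.zero ▸ hlow 0 (Nat.zero_le _), fun x hx => ?_, fun x hx => ?_⟩
    · rcases hall x hx with ⟨k, hk, rfl⟩ | ⟨k, hk, hkr, rfl⟩
      · exact (halow k hk).1
      · exact (hahigh k hk hkr).1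
    · rcases hall x hx with ⟨k, hk, rfl⟩ | ⟨k, hk, hkr, rfl⟩
      · exact (halow k hk).2
      · exact (hahigh k hk hkr).2
  refine ⟨(p r).1, (p r).2, hval r le_rfl (Or.inr hgG), hsnd r le_rfl hgG, ?_⟩
  -- `D` is a set of indices whose entries are redundant
  have build : ∀ D ⊆ Finset.Ioc (g + G) r,
      (∀ k ∈ D, ∃ l < k, g + G ≤ l ∧ l ∉ D ∧ (p k).1 = (p l).1) →
      ∃ S, IsChainSet S ∧ (p r).1 ∈ S ∧ S.card + D.card ≤ r + 1 - G := by
    intro D hD hdup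
    set S := (Finset.range (g + 1)).image a ∪
      (Finset.Ioc (g + G) r \ D).image fun k => (p k).1 with hSdef
    have hlow : ∀ k ≤ g, a k ∈ S := fun k hk => Finset.mem_union_left _
      (Finset.mem_image_of_mem _ (Finset.mem_range.2 (by omega)))
    have hhigh' : ∀ k, g + G ≤ k → k ≤ r → k ∉ D → (p k).1 ∈ S := fun k hk hkr hkD => by
      rcases eq_or_lt_of_le hk with rfl | hk
      · rw [pend]
        exact hlow g le_rfl
      · exact Finset.mem_union_right _ (Finset.mem_image_of_mem (fun k => (p k).1)
          (Finset.mem_sdiff.2 ⟨Finset.mem_Ioc.2 ⟨hk, hkr⟩, hkD⟩))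
    have hhigh : ∀ k, g + G ≤ k → k ≤ r → (p k).1 ∈ S := fun k hk hkr => by
      by_cases hkD : k ∈ D
      · obtain ⟨l, hl, hgl, hlD, heq⟩ := hdup k hkD
        exact heq ▸ hhigh' l hgl (by omega) hlD
      · exact hhigh' k hk hkr hkD
    refine ⟨S, hset S hlow hhigh fun x hx => ?_, hhigh r hgG le_rfl, ?_⟩
    · rcases Finset.mem_union.1 hx with hx | hx
      · obtain ⟨k, hk, rfl⟩ := Finset.mem_image.1 hx
        exact Or.inl ⟨k, by simpa [Nat.lt_succ_iff] using hk, rfl⟩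
      · obtain ⟨k, hk, rfl⟩ := Finset.mem_image.1 hx
        obtain ⟨hk1, hk2⟩ := Finset.mem_Ioc.1 (Finset.mem_sdiff.1 hk).1
        exact Or.inr ⟨k, hk1.le, hk2, rfl⟩
    · have h1 := Finset.card_union_le ((Finset.range (g + 1)).image a)
        ((Finset.Ioc (g + G) r \ D).image fun k => (p k).1)
      have h2 : ((Finset.range (g + 1)).image a).card ≤ _ := Finset.card_image_le
      have h3 : ((Finset.Ioc (g + G) r \ D).image fun k => (p k).1).card ≤ _ :=
        Finset.card_image_le
      rw [Finset.card_range] at h2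
      rw [Finset.card_sdiff_of_subset hD, Nat.card_Ioc] at h3
      have h4 := Finset.card_le_card hD
      rw [Nat.card_Ioc] at h4
      rw [← hSdef] at h1
      omega
  by_cases hb : (p r).2 = 0
  · obtain ⟨S, hS, hmS, hcard⟩ := build ∅ (Finset.empty_subset _) (by simp)
    exact ⟨S, hS, hmS, by simpa using hcard, fun hne => absurd hb hne⟩
  -- At the first index with nonzero remainder, one summand comes from before the run, so the
  -- quotient repeats that of the other summand and one element is saved.
  · have hex : ∃ k, g + G ≤ k ∧ k ≤ r ∧ (p k).2 ≠ 0 := ⟨r, hgG, le_rfl, hb⟩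
    obtain ⟨hk, hkr, hk0⟩ := Nat.find_spec hex
    set k := Nat.find hex with hkdef
    have hmin : ∀ l < k, g + G ≤ l → (p l).2 = 0 := fun l hl hgl => by
      by_contra hne
      exact Nat.find_min hex hl ⟨hgl, by omega, hne⟩
    have hk : g + G < k := lt_of_le_of_ne hk fun he => hk0 (by rw [← he, pend])
    have hik := h.left_lt k (by omega) hkr
    have hjk := h.right_lt k (by omega) hkr
    have hdup : ∃ l < k, g + G ≤ l ∧ (p k).1 = (p l).1 := by
      rcases hi k hk hkr with h1 | h1
      · have h2 := (hj k hk hkr).resolve_left fun h2 => hnot k hk hkr ⟨h1, h2⟩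
        exact ⟨j k, hjk, h2, by simp [phigh k hk hkr, plow _ h1]⟩
      rcases hj k hk hkr with h2 | h2
      · exact ⟨i k, hik, h1, by simp [phigh k hk hkr, plow _ h2]⟩
      · refine absurd ?_ hk0
        rw [phigh k hk hkr, Prod.snd_add, hmin _ hik h1, hmin _ hjk h2]
    obtain ⟨l, hlk, hgl, heq⟩ := hdup
    obtain ⟨S, hS, hmS, hcard⟩ := build {k}
      (Finset.singleton_subset_iff.2 (Finset.mem_Ioc.2 ⟨hk, hkr⟩)) (by
        intro k' hk'
        rw [Finset.mem_singleton.1 hk']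
        exact ⟨l, hlk, hgl, by simpa using hlk.ne, heq⟩)
    rw [Finset.card_singleton] at hcard
    exact ⟨S, hS, hmS, by omega, fun _ => by omega⟩

/-! ### Few non-doublings, hence a long isolated run -/

/-- The non-doubling steps of a chain. -/
def nondoublings (a : ℕ → ℕ) (r : ℕ) : Finset ℕ := {k ∈ Finset.Icc 1 r | a k ≠ 2 * a (k - 1)}

/-- The product of two consecutive elements grows by a factor at most 4 at each step, and at most 3
at a non-doubling. -/
lemma mul_four_pow_le (h : IncreasingChain r a i j) : ∀ k, k + 1 ≤ r →
    a (k + 1) * a k * 4 ^ (nondoublings a (k + 1)).card ≤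
      3 ^ (nondoublings a (k + 1)).card * 4 ^ (k + 1) := by
  intro k
  induction k with
  | zero =>
    intro hr
    have h1 := h.le_two_mul hr
    have h2 := h.lt 0 1 one_pos hr
    have h3 := h.zero
    have h4 : nondoublings a 1 = ∅ := by
      simp only [nondoublings, Finset.Icc_self, Finset.filter_eq_empty_iff, Finset.mem_singleton]
      rintro x rfl
      simp only [zero_add, tsub_self] at *
      omega
    simp only [zero_add] at *
    simp [h4, h3]
    omega
  | succ k ih =>
    intro hr
    have ih := ih (by omega)
    have h1 := h.le_two_mul (k := k) (by omega)
    have hIcc : Finset.Icc 1 (k + 1 + 1) = insert (k + 1 + 1) (Finset.Icc 1 (k + 1)) := by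
      ext; simp; omega
    by_cases hd : a (k + 1 + 1) = 2 * a (k + 1)
    · have hN : nondoublings a (k + 1 + 1) = nondoublings a (k + 1) := by
        rw [nondoublings, hIcc, Finset.filter_insert, if_neg (by simpa using hd), nondoublings]
      rw [hN, hd]
      calc 2 * a (k + 1) * a (k + 1) * 4 ^ (nondoublings a (k + 1)).card
          ≤ 2 * a (k + 1) * (2 * a k) * 4 ^ (nondoublings a (k + 1)).card := by gcongr
        _ = 4 * (a (k + 1) * a k * 4 ^ (nondoublings a (k + 1)).card) := by ring
        _ ≤ 4 * (3 ^ (nondoublings a (k + 1)).card * 4 ^ (k + 1)) := by gcongr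
        _ = _ := by ring
    · have hN : (nondoublings a (k + 1 + 1)).card = (nondoublings a (k + 1)).card + 1 := by
        rw [nondoublings, hIcc, Finset.filter_insert, if_pos (by simpa using hd),
          Finset.card_insert_of_notMem (by simp), nondoublings]
      -- Some summand is at most a k, and the other is at most a (k + 1) ≤ 2 · a k.
      have h3 : a (k + 1 + 1) ≤ 3 * a k := by
        have hi := h.left_lt (k + 1 + 1) (by omega) hr
        have hj := h.right_lt (k + 1 + 1) (by omega) hr
        have he := h.eq_add (k + 1 + 1) (by omega) hr
        have hile := h.le (k := i (k + 1 + 1)) (l := k + 1) (by omega) (by omega)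
        have hjle := h.le (k := j (k + 1 + 1)) (l := k + 1) (by omega) (by omega)
        by_cases hik : i (k + 1 + 1) = k + 1
        · by_cases hjk : j (k + 1 + 1) = k + 1
          · rw [hik, hjk] at he
            omega
          · have := h.le (k := j (k + 1 + 1)) (l := k) (by omega) (by omega)
            omega
        · have := h.le (k := i (k + 1 + 1)) (l := k) (by omega) (by omega)
          omega
      rw [hN]
      calc a (k + 1 + 1) * a (k + 1) * 4 ^ ((nondoublings a (k + 1)).card + 1)
          ≤ 3 * a k * a (k + 1) * 4 ^ ((nondoublings a (k + 1)).card + 1) := by gcongr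
        _ = 12 * (a (k + 1) * a k * 4 ^ (nondoublings a (k + 1)).card) := by ring
        _ ≤ 12 * (3 ^ (nondoublings a (k + 1)).card * 4 ^ (k + 1)) := by gcongr
        _ = _ := by ring

/-- For r ≥ 2, the product bound and a r ≥ 2^(r - 2) give (4/3)^N ≤ 32 for the number N of
non-doublings, which fails from N = 13 on. -/
lemma card_nondoublings_le (h : IncreasingChain r a i j) (hr : r ≤ Nat.log 2 (a r) + 2) :
    (nondoublings a r).card ≤ 12 := by
  obtain hr2 | ⟨k, rfl⟩ : r < 2 ∨ ∃ k, r = k + 2 := by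
    rcases lt_or_ge r 2 with h | h
    · exact Or.inl h
    · exact Or.inr ⟨r - 2, by omega⟩
  · have := Finset.card_filter_le (Finset.Icc 1 r) fun k => a k ≠ 2 * a (k - 1)
    rw [Nat.card_Icc] at this
    rw [nondoublings]
    omega
  by_contra! hN
  have h1 := h.mul_four_pow_le (k + 1) le_rfl
  have h2 := h.le_two_mul (k := k + 1) le_rfl
  have h3 : 2 ^ k ≤ a (k + 2) := (Nat.pow_le_pow_right (by norm_num) (by omega)).trans
    (Nat.pow_log_le_self 2 (h.pos le_rfl).ne')
  obtain ⟨t, ht⟩ : ∃ t, (nondoublings a (k + 1 + 1)).card = 13 + t :=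
    ⟨(nondoublings a (k + 2)).card - 13, by
      rw [show k + 1 + 1 = k + 2 from rfl]; omega⟩
  rw [ht] at h1
  have h4 : 2 ^ k * 2 ^ k * 4 ^ (13 + t) ≤ 2 * (3 ^ (13 + t) * 4 ^ (k + 1 + 1)) := by
    calc 2 ^ k * 2 ^ k * 4 ^ (13 + t) ≤ a (k + 2) * a (k + 2) * 4 ^ (13 + t) := by gcongr
      _ ≤ a (k + 2) * (2 * a (k + 1)) * 4 ^ (13 + t) := by gcongr
      _ = 2 * (a (k + 1 + 1) * a (k + 1) * 4 ^ (13 + t)) := by ring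
      _ ≤ _ := by gcongr
  have h5 : 3 ^ t ≤ 4 ^ t := Nat.pow_le_pow_left (by norm_num) t
  have h6 : 2 ^ k * 2 ^ k = 4 ^ k := by rw [← mul_pow]; norm_num
  have h7 : 4 ^ k * (67108864 * 4 ^ t) ≤ 4 ^ k * (51018336 * 3 ^ t) := by
    rw [h6] at h4
    convert h4 using 1 <;> ring
  have h8 := Nat.le_of_mul_le_mul_left h7 (by positivity)
  have := Nat.pow_pos (n := t) (show 0 < 3 by norm_num)
  omega

/-- A long chain with few small steps has a long run of doublings that is not referred to from
outside. -/
lemma exists_run (h : IncreasingChain r a i j) (hr : r ≤ Nat.log 2 (a r) + 2) {G : ℕ} (hG : 1 ≤ G)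
    (hGr : 37 * G ≤ r) : ∃ g, g + G ≤ r ∧
      (∀ k, g < k → k ≤ g + G → a k = 2 * a (k - 1)) ∧
      (∀ k, g + G < k → k ≤ r → i k ≤ g ∨ g + G ≤ i k) ∧
      ∀ k, g + G < k → k ≤ r → j k ≤ g ∨ g + G ≤ j k := by
  classical
  set N := nondoublings a r with hNdef
  have hN : N.card ≤ 12 := h.card_nondoublings_le hr
  have hmemN : ∀ k, 1 ≤ k → k ≤ r → k ∉ N → a k = 2 * a (k - 1) := fun k h1 h2 h3 => by
    by_contra hne
    exact h3 (Finset.mem_filter.2 ⟨Finset.mem_Icc.2 ⟨h1, h2⟩, hne⟩)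
  -- Each non-doubling marks itself and its two summand indices: at most 36 marks, so one of 37
  -- blocks of length G has none.
  set P := N ∪ (N.image i ∪ N.image j) with hP
  have hPc : P.card ≤ 36 := by
    have h1 := Finset.card_union_le N (N.image i ∪ N.image j)
    have h2 := Finset.card_union_le (N.image i) (N.image j)
    have h3 : (N.image i).card ≤ N.card := Finset.card_image_le
    have h4 : (N.image j).card ≤ N.card := Finset.card_image_le
    rw [hP]
    omega
  obtain ⟨b, hb, hbP⟩ : ∃ b < 37, ∀ x ∈ P, ¬ (b * G < x ∧ x ≤ (b + 1) * G) := by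
    by_contra! hall
    have hsub : Finset.range 37 ⊆ P.image fun x => (x - 1) / G := by
      intro b hb
      obtain ⟨x, hx, hlt, hle⟩ := hall b (Finset.mem_range.1 hb)
      refine Finset.mem_image.2 ⟨x, hx, ?_⟩
      exact Nat.div_eq_of_lt_le (by omega) (by omega)
    have := (Finset.card_le_card hsub).trans Finset.card_image_le
    rw [Finset.card_range] at this
    omega
  have hbG : (b + 1) * G = b * G + G := by ring
  have hbr : b * G + G ≤ r := by
    have : (b + 1) * G ≤ 37 * G := Nat.mul_le_mul_right _ (by omega)
    omega
  rw [hbG] at hbP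
  have hout : ∀ x ∈ P, x ≤ b * G ∨ b * G + G ≤ x := fun x hx => by
    have := hbP x hx
    omega
  refine ⟨b * G, hbr, fun k h1 h2 => hmemN k (by omega) (by omega) fun hk =>
    hbP k (Finset.mem_union_left _ hk) ⟨h1, h2⟩, fun k h1 h2 => ?_, fun k h1 h2 => ?_⟩
  all_goals
    by_cases hk : k ∈ N
    · exact hout _ (Finset.mem_union_right _
        (by simp only [Finset.mem_union, Finset.mem_image]; grind))
    -- A doubling after the run refers only to k - 1 ≥ g + G.
    · have := h.doubling k (by omega) h2 (hmemN k (by omega) h2 hk)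
      omega

end IncreasingChain

/-! ### Order types of sets of reals -/

open Ordinal in
/-- A strictly monotone map into the ordinals below `o` bounds the order type by `o`. -/
lemma exists_hasOrderType_le {S : Set ℝ} {o : Ordinal.{0}} (f : S → Ordinal.{0})
    (hf : StrictMono f) (hlt : ∀ x, f x < o) : ∃ o', HasOrderType S o' ∧ o' ≤ o := by
  have hwf : WellFounded (fun x y : S => x < y) := hf.wellFoundedLT.wf
  have : IsWellOrder S (fun x y => x < y) := { wf := hwf }
  refine ⟨_, ⟨this, rfl⟩, ?_⟩
  rw [← Ordinal.type_toType o]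
  refine Ordinal.type_le_iff'.2 ⟨RelEmbedding.ofMonotone
    (fun x => Ordinal.ToType.mk ⟨f x, hlt x⟩) fun x y hxy => ?_⟩
  exact Ordinal.ToType.mk.lt_iff_lt.2 (hf hxy)

open Ordinal in
/-- If the points of `c` cut `S` into locally finitely many pieces, each of which has finite initial
segments, then `S` is well-ordered, with order type bounded by the number of pieces. -/
lemma exists_hasOrderType_of_cuts {S : Set ℝ} {o : Ordinal.{0}} (c : ℕ → ℝ)
    (hc : ∀ x ∈ S, {i | c i ≤ x}.Finite)
    (hS : ∀ x ∈ S, {y ∈ S | y < x ∧ ∀ i, c i ≤ x → c i ≤ y}.Finite)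
    (ho : ∀ x ∈ S, ω * ({i | c i ≤ x}.ncard + 1 : ℕ) ≤ o) :
    ∃ o', HasOrderType S o' ∧ o' ≤ o := by
  have hlt : ∀ (a b : ℕ), ω * (a : Ordinal.{0}) + b < ω * (a + 1 : ℕ) := fun a b => by
    rw [Nat.cast_add, Nat.cast_one, mul_add_one]
    exact add_lt_add_right (natCast_lt_omega0 b) _
  -- The rank of x is ω times the number of cuts up to x, plus the position of x in its piece.
  refine exists_hasOrderType_le (fun x => ω * ({i | c i ≤ x.1}.ncard : Ordinal.{0}) +
    {y ∈ S | y < x ∧ ∀ i, c i ≤ x → c i ≤ y}.ncard) ?_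
    fun x => (hlt _ _).trans_le (ho x x.2)
  rintro ⟨x, hx⟩ ⟨y, hy⟩ hxy
  have hxy' : x < y := hxy
  have hsub : {i | c i ≤ x} ⊆ {i | c i ≤ y} := fun i hi => le_trans hi hxy'.le
  by_cases hall : ∀ i, c i ≤ y → c i ≤ x
  · have heq : {i | c i ≤ x} = {i | c i ≤ y} := Set.Subset.antisymm hsub hall
    have hcard : {z ∈ S | z < x ∧ ∀ i, c i ≤ x → c i ≤ z}.ncard <
        {z ∈ S | z < y ∧ ∀ i, c i ≤ y → c i ≤ z}.ncard := by
      refine Set.ncard_lt_ncard ⟨?_, fun h => ?_⟩ (hS y hy)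
      · rintro z ⟨hz, hzx, hzc⟩
        exact ⟨hz, hzx.trans hxy', fun i hi => hzc i (hall i hi)⟩
      · exact lt_irrefl x (h ⟨hx, hxy', hall⟩).2.1
    simp only [heq]
    exact add_lt_add_right (Nat.cast_lt.2 hcard) _
  · push Not at hall
    obtain ⟨i, hiy, hix⟩ := hall
    have hcard : {i | c i ≤ x}.ncard < {i | c i ≤ y}.ncard :=
      Set.ncard_lt_ncard ⟨hsub, fun h => hix.not_ge (h hiy)⟩ (hc y hy)
    refine (hlt _ _).trans_le (le_trans ?_ le_self_add)
    exact mul_le_mul_right (Nat.cast_le.2 hcard) _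

open Ordinal in
lemma omega0_sq_le_of_hasOrderType {S : Set ℝ} {o : Ordinal.{0}} (h : HasOrderType S o)
    (f : ℕ → ℕ → ℝ) (hf : ∀ i j, f i j ∈ S)
    (hlt : ∀ i j i' j', i < i' ∨ i = i' ∧ j < j' → f i j < f i' j') : ω ^ 2 ≤ o := by
  obtain ⟨hwo, rfl⟩ := h
  have h2 : (ω : Ordinal.{0}) ^ 2 = Ordinal.type (Prod.Lex (fun x y : ℕ => x < y)
      (fun x y : ℕ => x < y)) := by
    rw [Ordinal.type_prod_lex, Ordinal.type_nat_lt, sq]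
  rw [h2]
  refine Ordinal.type_le_iff'.2 ⟨RelEmbedding.ofMonotone (fun p => ⟨f p.1 p.2, hf _ _⟩) ?_⟩
  rintro ⟨i, j⟩ ⟨i', j'⟩ hlex
  exact hlt _ _ _ _ (Prod.lex_def.1 hlex)

/-! ### Accumulation of mantissas -/

lemma HasSmallSteps.pos {s n : ℕ} (h : HasSmallSteps s n) : 0 < n := by
  obtain ⟨S, hS, hn, -⟩ := h
  exact hS.pos n hn

/-- The factor `n / 2 ^ ⌊log₂ n⌋ ∈ [1, 2)`. -/
noncomputable def mantissa (n : ℕ) : ℝ := n / 2 ^ Nat.log 2 n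

lemma one_le_mantissa {n : ℕ} (hn : 0 < n) : 1 ≤ mantissa n := by
  rw [mantissa, one_le_div (by positivity)]
  exact_mod_cast Nat.pow_log_le_self 2 hn.ne'

lemma mantissa_lt_two (n : ℕ) : mantissa n < 2 := by
  rw [mantissa, div_lt_iff₀ (by positivity), ← pow_succ']
  exact_mod_cast Nat.lt_pow_succ_log_self (by norm_num) n

lemma log_two_pow_mul (k : ℕ) {n : ℕ} (hn : 0 < n) : Nat.log 2 (2 ^ k * n) = k + Nat.log 2 n := by
  induction k with
  | zero => simp
  | succ k ih =>
    have : 2 ^ k * n ≠ 0 := by positivity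
    rw [pow_succ, mul_right_comm, Nat.log_mul_base (by norm_num) this, ih]
    omega

lemma mantissa_two_pow_mul (k : ℕ) {n : ℕ} (hn : 0 < n) : mantissa (2 ^ k * n) = mantissa n := by
  rw [mantissa, mantissa, log_two_pow_mul k hn, pow_add]
  push_cast
  rw [mul_div_mul_left _ _ (by positivity)]

lemma IsTwoBit.mantissa_eq {n : ℕ} (h : IsTwoBit n) :
    mantissa n = 1 ∨ ∃ k : ℕ, mantissa n = 1 + (1 / 2) ^ (k + 1) := by
  rcases h.eq_log with h | ⟨j, hj, h⟩
  · left
    rw [mantissa]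
    nth_rewrite 1 [h]
    simp
  · right
    obtain ⟨k, hk⟩ : ∃ k, Nat.log 2 n = j + (k + 1) := ⟨Nat.log 2 n - j - 1, by omega⟩
    refine ⟨k, ?_⟩
    rw [mantissa]
    nth_rewrite 1 [h]
    rw [hk]
    push_cast
    rw [add_div, div_self (by positivity), pow_add _ j, div_mul_eq_div_div,
      div_self (by positivity), div_pow, one_pow]

/-- The mantissas of numbers with at most two small steps accumulate from above only at the
mantissas of numbers with at most one small step. -/
lemma finite_mantissa {ε : ℝ} (hε : 0 < ε) :
    (mantissa '' {n | HasSmallSteps 2 n ∧ 1 + ε ≤ mantissa n ∧ ∀ k : ℕ,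
      1 + (1 / 2) ^ (k + 1) < mantissa n → 1 + (1 / 2) ^ (k + 1) + ε ≤ mantissa n}).Finite := by
  obtain ⟨G, hG⟩ : ∃ G : ℕ, (1 / 2 : ℝ) ^ G < ε / 4 :=
    exists_pow_lt_of_lt_one (by positivity) (by norm_num)
  obtain ⟨G, hG1, hG⟩ : ∃ G : ℕ, 1 ≤ G ∧ 4 * (1 / 2 : ℝ) ^ G < ε := by
    refine ⟨G + 1, by omega, ?_⟩
    have : (0 : ℝ) < (1 / 2) ^ G := by positivity
    rw [pow_succ]
    linarith
  refine ((Set.finite_Iio (2 ^ (37 * G))).image mantissa).subset ?_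
  rintro _ ⟨n, ⟨hn, hn1, hnk⟩, rfl⟩
  classical
  -- The least number q with this mantissa is shown to be below 2^(37 · G), which leaves finitely
  -- many mantissas.
  have hex : ∃ m, HasSmallSteps 2 m ∧ mantissa m = mantissa n := ⟨n, hn, rfl⟩
  obtain ⟨h2, hmant⟩ := Nat.find_spec hex
  have hmin : ∀ m < Nat.find hex, ¬ (HasSmallSteps 2 m ∧ mantissa m = mantissa n) :=
    fun m hm => Nat.find_min hex hm
  generalize Nat.find hex = q at *
  refine ⟨q, ?_, hmant⟩
  by_contra hlarge
  have hlarge : 2 ^ (37 * G) ≤ q := not_lt.1 hlarge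
  rw [← hmant] at hn1 hnk hmin
  have hq := h2.pos
  obtain ⟨S, hS, hqS, hcard⟩ := h2
  obtain ⟨r, a, i, j, hch, haq, hrc⟩ := hS.exists_increasingChain hqS
  have hGlog : 37 * G ≤ Nat.log 2 q := Nat.le_log_of_pow_le (by norm_num) hlarge
  have hlogr : Nat.log 2 q ≤ r := by
    have := Nat.log_mono_right (b := 2) (hch.le_two_pow le_rfl)
    rwa [haq, Nat.log_pow (by norm_num)] at this
  obtain ⟨g, hgr, hrun, hi, hj⟩ := hch.exists_run (by rw [haq]; omega) hG1 (hGlog.trans hlogr)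
  obtain ⟨m, b, hqm, hb, T, hT, hmT, hTc, hTb⟩ := hch.exists_split hG1 hgr hrun hi hj
  rw [haq] at hqm
  have hm := hT.pos m hmT
  have hbε : (b : ℝ) / 2 ^ Nat.log 2 q ≤ 4 * (1 / 2) ^ G := by
    have h1 : b * 2 ^ G ≤ 4 * 2 ^ Nat.log 2 q := by
      calc b * 2 ^ G ≤ 2 ^ (r - G) * 2 ^ G := by gcongr
        _ = 2 ^ r := by rw [← pow_add]; congr 1; omega
        _ ≤ 2 ^ (Nat.log 2 q + 2) := Nat.pow_le_pow_right (by norm_num) (by omega)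
        _ = 4 * 2 ^ Nat.log 2 q := by ring
    rw [one_div, inv_pow, ← div_eq_mul_inv, div_le_div_iff₀ (by positivity) (by positivity)]
    exact_mod_cast h1
  -- If b = 0, then m is a smaller number with the same mantissa, against minimality.
  rcases eq_or_ne b 0 with rfl | hb0
  · rw [add_zero] at hqm
    have hlog := log_two_pow_mul G hm
    rw [← hqm] at hlog
    refine hmin m ?_ ⟨⟨T, hT, hmT, by omega⟩, by rw [hqm, mantissa_two_pow_mul G hm]⟩
    have : 2 ^ 1 * m ≤ 2 ^ G * m := Nat.mul_le_mul_right _ (Nat.pow_le_pow_right (by norm_num) hG1)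
    omega
  have hTb := hTb hb0
  have hsplit : mantissa q = ((2 ^ G * m : ℕ) : ℝ) / 2 ^ Nat.log 2 q + b / 2 ^ Nat.log 2 q := by
    rw [← add_div, mantissa]
    nth_rewrite 1 [hqm]
    push_cast
    rfl
  -- If 2^G · m misses the dyadic interval of q, the mantissa of q is below 1 + ε. Otherwise m has
  -- at most one small step, and q lies less than ε above a two-bit mantissa.
  rcases lt_or_ge (2 ^ G * m) (2 ^ Nat.log 2 q) with hlt | hge
  · have : ((2 ^ G * m : ℕ) : ℝ) / 2 ^ Nat.log 2 q < 1 := by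
      rw [div_lt_one (by positivity)]
      exact_mod_cast hlt
    linarith
  have hlog : Nat.log 2 (2 ^ G * m) = Nat.log 2 q :=
    le_antisymm (Nat.log_mono_right (by omega)) (Nat.le_log_of_pow_le (by norm_num) hge)
  have hbpos : (0 : ℝ) < b / 2 ^ Nat.log 2 q := by positivity
  rw [← hlog, ← mantissa, mantissa_two_pow_mul G hm, hlog] at hsplit
  have hlog' := log_two_pow_mul G hm
  have h1 : HasSmallSteps 1 m := ⟨T, hT, hmT, by omega⟩
  rcases h1.isTwoBit.mantissa_eq with h | ⟨k, h⟩
  · linarith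
  · have := hnk k (by linarith)
    linarith

/-! ### Defects between consecutive cuts -/

/-- The accumulation points of the defects in `[0, 2)`. -/
noncomputable def cut (i : ℕ) : ℝ := 2 - Real.logb 2 (1 + (1 / 2) ^ i)

lemma cut_zero : cut 0 = 1 := by
  norm_num [cut, Real.logb_self_eq_one]

lemma cut_strictMono : StrictMono cut := by
  intro i j hij
  have h : (1 / 2 : ℝ) ^ j < (1 / 2) ^ i :=
    pow_lt_pow_right_of_lt_one₀ (by norm_num) (by norm_num) hij
  have := Real.logb_lt_logb (b := 2) (by norm_num) (x := 1 + (1 / 2) ^ j)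
    (y := 1 + (1 / 2) ^ i) (by positivity) (by linarith)
  rw [cut, cut]
  linarith

lemma exists_lt_cut {x : ℝ} (hx : x < 2) : ∃ i, x < cut i := by
  have h1 : (1 : ℝ) < 2 ^ (2 - x) := Real.one_lt_rpow (by norm_num) (by linarith)
  obtain ⟨i, hi⟩ : ∃ i : ℕ, (1 / 2 : ℝ) ^ i < 2 ^ (2 - x) - 1 :=
    exists_pow_lt_of_lt_one (by linarith) (by norm_num)
  refine ⟨i, ?_⟩
  have := (Real.logb_lt_iff_lt_rpow (b := 2) (by norm_num) (x := 1 + (1 / 2) ^ i) (y := 2 - x)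
    (by positivity)).2 (by linarith)
  rw [cut]
  linarith

lemma finite_cut_le {x : ℝ} (hx : x < 2) : {i | cut i ≤ x}.Finite := by
  obtain ⟨j, hj⟩ := exists_lt_cut hx
  refine (Set.finite_Iio j).subset fun i hi => ?_
  exact cut_strictMono.lt_iff_lt.1 (lt_of_le_of_lt hi hj)

namespace AdditionChain

namespace Admissible

variable {A : Set AdditionChain} {n : ℕ} {x : ℝ}

lemma defect_eq (hA : Admissible A) (hn : 1 ≤ n) :
    defect A n = ((len A n - Nat.log 2 n : ℕ) : ℝ) - Real.logb 2 (mantissa n) := by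
  rw [Nat.cast_sub (hA.log_le_len hn), mantissa, Real.logb_div (by positivity) (by positivity),
    Real.logb_pow, Real.logb_self_eq_one (by norm_num), defect]
  ring

lemma len_le_of_defect_le (hA : Admissible A) (hn : 1 ≤ n) (h : defect A n ≤ 2) :
    len A n ≤ Nat.log 2 n + 2 := by
  have h1 : Real.logb 2 (mantissa n) < 1 := by
    rw [Real.logb_lt_iff_lt_rpow (by norm_num) (by linarith [one_le_mantissa hn]), Real.rpow_one]
    exact mantissa_lt_two n
  rw [hA.defect_eq hn] at h
  have h2 : ((len A n - Nat.log 2 n : ℕ) : ℝ) < (3 : ℕ) := by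
    push_cast
    linarith
  have := Nat.cast_lt.1 h2
  omega

/-- The defects up to `2` in terms of small steps and mantissas. -/
lemma exists_of_mem_defects (hA : Admissible A) (hx : x ∈ defects A ∩ Set.Icc 0 2) :
    x < 2 ∧ ∃ s ≤ 2, ∃ n, HasSmallSteps s n ∧ x = s - Real.logb 2 (mantissa n) := by
  obtain ⟨⟨n, hn, rfl⟩, -, hx2⟩ := hx
  have hl := hA.len_le_of_defect_le hn hx2
  have hlog := hA.log_le_len hn
  -- A defect equal to 2 would need two small steps and mantissa 1, but the binary bound gives
  -- powers of two no small step.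
  refine ⟨lt_of_le_of_ne hx2 fun h => ?_, len A n - Nat.log 2 n, by omega, n,
    hA.hasSmallSteps hn (by omega), hA.defect_eq hn⟩
  have h0 : 0 ≤ Real.logb 2 (mantissa n) := Real.logb_nonneg (by norm_num) (one_le_mantissa hn)
  rw [hA.defect_eq hn] at h
  have hs : len A n - Nat.log 2 n = 2 := by
    have : (2 : ℕ) ≤ ((len A n - Nat.log 2 n : ℕ) : ℝ) := by
      push_cast
      linarith
    have := Nat.cast_le.1 this
    omega
  rw [hs] at h
  push_cast at h
  have h1 : mantissa n = 1 := by
    by_contra hne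
    have := Real.logb_pos (b := 2) (by norm_num) (lt_of_le_of_ne (one_le_mantissa hn) (Ne.symm hne))
    linarith
  rw [mantissa, div_eq_one_iff_eq (by positivity)] at h1
  have h1 : n = 2 ^ Nat.log 2 n := by exact_mod_cast h1
  have h2 := hA.len_le hn
  have h3 : nu2 n = 1 := by rw [h1, nu2_two_pow]
  omega

lemma finite_between_cuts (hA : Admissible A) (hx : x < 2) :
    {y ∈ defects A ∩ Set.Icc 0 2 | y < x ∧ ∀ i, cut i ≤ x → cut i ≤ y}.Finite := by
  -- Below 1, s = 0 gives only 0, s = 1 gives values `cut i - 1`, finitely many of them below x, and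
  -- s = 2 gives values above 1.
  rcases lt_or_ge x 1 with hx1 | hx1
  · refine ((((finite_cut_le (x := x + 1) (by linarith)).image fun i => cut i - 1).insert
      0)).subset ?_
    rintro y ⟨hy, hyx, -⟩
    have hy0 : 0 ≤ y := hy.2.1
    obtain ⟨-, s, hs, n, hsn, rfl⟩ := hA.exists_of_mem_defects hy
    have hn := hsn.pos
    have h0 : 0 ≤ Real.logb 2 (mantissa n) := Real.logb_nonneg (by norm_num) (one_le_mantissa hn)
    have h1 : Real.logb 2 (mantissa n) < 1 := by
      rw [Real.logb_lt_iff_lt_rpow (by norm_num) (by linarith [one_le_mantissa hn]), Real.rpow_one]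
      exact mantissa_lt_two n
    interval_cases s
    · left
      push_cast at hy0 ⊢
      linarith
    · push_cast at hy0 hyx ⊢
      rcases hsn.isTwoBit.mantissa_eq with h | ⟨k, h⟩
      · rw [h, Real.logb_one] at hyx
        linarith
      · right
        refine ⟨k + 1, ?_, ?_⟩
        · change cut (k + 1) ≤ x + 1
          rw [cut, ← h]
          linarith
        · simp only [cut, ← h]
          ring
    · push_cast at hyx
      linarith
  · obtain ⟨i, hix, hxi⟩ : ∃ i, cut i ≤ x ∧ x < cut (i + 1) := by
      classical
      have hex := exists_lt_cut hx
      obtain ⟨i, hi⟩ : ∃ i, Nat.find hex = i + 1 := by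
        refine Nat.exists_eq_succ_of_ne_zero fun h0 => ?_
        have := Nat.find_spec hex
        rw [h0, cut_zero] at this
        linarith
      exact ⟨i, not_lt.1 (Nat.find_min hex (by omega)), hi ▸ Nat.find_spec hex⟩
    -- A defect y < x with s = 2 has mantissa above 2^(2 - x), hence more than this ε above the next
    -- two-bit mantissa 1 + 2^(-(i+1)).
    have hε : 0 < (2 : ℝ) ^ (2 - x) - (1 + (1 / 2) ^ (i + 1)) := by
      rw [sub_pos, ← Real.logb_lt_iff_lt_rpow (by norm_num) (by positivity)]
      rw [cut] at hxi
      linarith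
    refine (((finite_mantissa hε).image fun w => 2 - Real.logb 2 w).insert 1).subset ?_
    rintro y ⟨hy, hyx, hcut⟩
    have hiy := hcut i hix
    have h1y : 1 ≤ y := cut_zero ▸ (cut_strictMono.monotone (Nat.zero_le i)).trans hiy
    obtain ⟨-, s, hs, n, hsn, rfl⟩ := hA.exists_of_mem_defects hy
    have hn := hsn.pos
    have h0 : 0 ≤ Real.logb 2 (mantissa n) := Real.logb_nonneg (by norm_num) (one_le_mantissa hn)
    have hm1 := one_le_mantissa hn
    interval_cases s
    · push_cast at h1y
      linarith
    · left
      push_cast at h1y ⊢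
      linarith
    · right
      push_cast at hyx hiy ⊢
      have hw : (2 : ℝ) ^ (2 - x) < mantissa n := by
        rw [← Real.lt_logb_iff_rpow_lt (by norm_num) (by linarith)]
        linarith
      have hw' : mantissa n ≤ 1 + (1 / 2) ^ i := by
        rw [← Real.logb_le_logb (b := 2) (by norm_num) (by linarith) (by positivity)]
        rw [cut] at hiy
        linarith
      refine ⟨_, ⟨n, ⟨hsn, ?_, fun k hk => ?_⟩, rfl⟩, rfl⟩
      · have : (0 : ℝ) < (1 / 2) ^ (i + 1) := by positivity
        linarith
      · have hki : i < k + 1 := by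
          rw [← pow_lt_pow_iff_right_of_lt_one₀ (a := (1 / 2 : ℝ)) (by norm_num) (by norm_num)]
          linarith
        have : (1 / 2 : ℝ) ^ (k + 1) ≤ (1 / 2) ^ (i + 1) :=
          pow_le_pow_of_le_one (by norm_num) (by norm_num) hki
        linarith

lemma exists_hasOrderType (hA : Admissible A) {S : Set ℝ} (hS : S ⊆ defects A ∩ Set.Icc 0 2)
    {o : Ordinal.{0}} (ho : ∀ x ∈ S, ω * ({i | cut i ≤ x}.ncard + 1 : ℕ) ≤ o) :
    ∃ o', HasOrderType S o' ∧ o' ≤ o := by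
  have h2 : ∀ x ∈ S, x < 2 := fun x hx => (hA.exists_of_mem_defects (hS hx)).1
  exact exists_hasOrderType_of_cuts cut (fun x hx => finite_cut_le (h2 x hx))
    (fun x hx => (hA.finite_between_cuts (h2 x hx)).subset fun y hy => ⟨hS hy.1, hy.2⟩) ho

lemma exists_hasOrderType_lt (hA : Admissible A) {r : ℝ} (hr : r < 2) :
    ∃ o, HasOrderType (defects A ∩ Set.Icc 0 r) o ∧ o < ω ^ 2 := by
  obtain ⟨o, ho, hle⟩ := hA.exists_hasOrderType (S := defects A ∩ Set.Icc 0 r)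
    (o := ω * ({i | cut i ≤ r}.ncard + 1 : ℕ))
    (fun x hx => ⟨hx.1, hx.2.1, hx.2.2.trans hr.le⟩) fun x hx => by
      have hsub : {i | cut i ≤ x} ⊆ {i | cut i ≤ r} := fun i hi => le_trans hi hx.2.2
      have := Set.ncard_le_ncard hsub (finite_cut_le hr)
      exact mul_le_mul_right (Nat.cast_le.2 (by omega)) _
  refine ⟨o, ho, hle.trans_lt ?_⟩
  rw [sq]
  exact (mul_lt_mul_iff_right₀ Ordinal.omega0_pos).2 (Ordinal.natCast_lt_omega0 _)

/-! ### The order type ω² -/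

/-- The number 2^(i+j+2) + 2^(j+1) + 1 has three binary ones: one small step is too few, and the
binary bound allows two. -/
lemma defect_three_ones (hA : Admissible A) (i j : ℕ) :
    2 - Real.logb 2 (1 + (1 / 2) ^ (i + 1) + (1 / 2) ^ (i + j + 2)) ∈
      defects A ∩ Set.Icc 0 2 := by
  set n := 2 ^ (i + j + 2) + (2 ^ (j + 1) + 1) with hn
  have h1 : (1 : ℕ) < 2 ^ (j + 1) := Nat.one_lt_two_pow (by omega)
  have h2 : 2 * 2 ^ (j + 1) ≤ 2 ^ (i + j + 2) := by
    rw [← pow_succ']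
    exact Nat.pow_le_pow_right (by norm_num) (by omega)
  have hlog : Nat.log 2 n = i + j + 2 :=
    Nat.log_eq_of_pow_le_of_lt_pow (Nat.le_add_right _ _) (by rw [pow_succ]; omega)
  have hnu : nu2 n = 3 := by
    rw [hn, nu2_two_pow_add (by omega), nu2_two_pow_add h1]
    simp [nu2]
  have hn1 : 1 ≤ n := by omega
  have hle := hA.len_le hn1
  have hlen : len A n = i + j + 4 := by
    by_contra hne
    have := hA.log_le_len hn1
    have := hA.nu2_le_of_len_le hn1 (s := 1) le_rfl (by omega)
    omega
  have hmant : mantissa n = 1 + (1 / 2) ^ (i + 1) + (1 / 2) ^ (i + j + 2) := by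
    rw [mantissa, hlog, hn, div_eq_iff (by positivity)]
    push_cast
    rw [add_mul, add_mul, one_mul, ← mul_pow, show i + j + 2 = (i + 1) + (j + 1) by omega,
      pow_add (2 : ℝ) (i + 1), ← mul_assoc, ← mul_pow]
    norm_num
    ring
  have hd : defect A n = 2 - Real.logb 2 (1 + (1 / 2) ^ (i + 1) + (1 / 2) ^ (i + j + 2)) := by
    rw [hA.defect_eq hn1, hlen, hlog, hmant, show i + j + 4 - (i + j + 2) = 2 by omega]
    norm_num
  have h0 : 0 ≤ Real.logb 2 (mantissa n) := Real.logb_nonneg (by norm_num) (one_le_mantissa hn1)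
  have h3 : Real.logb 2 (mantissa n) < 1 := by
    rw [Real.logb_lt_iff_lt_rpow (by norm_num) (by linarith [one_le_mantissa hn1]), Real.rpow_one]
    exact mantissa_lt_two n
  rw [hmant] at h0 h3
  exact ⟨⟨n, hn1, hd⟩, by linarith, by linarith⟩

lemma hasOrderType_defects (hA : Admissible A) :
    HasOrderType (defects A ∩ Set.Icc 0 2) (ω ^ 2) := by
  obtain ⟨o, ho, hle⟩ := hA.exists_hasOrderType (o := ω ^ 2) subset_rfl fun x _ => by
    rw [sq]
    exact mul_le_mul_right (Ordinal.natCast_lt_omega0 _).le _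
  have hge := omega0_sq_le_of_hasOrderType ho
    (fun i j => 2 - Real.logb 2 (1 + (1 / 2) ^ (i + 1) + (1 / 2) ^ (i + j + 2)))
    hA.defect_three_ones fun i j i' j' h => by
      -- Raising j lowers the mantissa. Raising i to i' lowers it past every j, since the two new
      -- fractions sum to at most 2^(-i') ≤ 2^(-(i+1)).
      have hlt : (1 / 2 : ℝ) ^ (i' + 1) + (1 / 2) ^ (i' + j' + 2) <
          (1 / 2) ^ (i + 1) + (1 / 2) ^ (i + j + 2) := by
        rcases h with h | ⟨rfl, h⟩
        · have h1 : (1 / 2 : ℝ) ^ (i' + j' + 2) ≤ (1 / 2) ^ (i' + 1) :=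
            pow_le_pow_of_le_one (by norm_num) (by norm_num) (by omega)
          have h2 : (1 / 2 : ℝ) ^ i' ≤ (1 / 2) ^ (i + 1) :=
            pow_le_pow_of_le_one (by norm_num) (by norm_num) h
          have h3 : (0 : ℝ) < (1 / 2) ^ (i + j + 2) := by positivity
          rw [pow_succ _ i'] at h1 ⊢
          linarith
        · have : (1 / 2 : ℝ) ^ (i + j' + 2) < (1 / 2) ^ (i + j + 2) :=
            pow_lt_pow_right_of_lt_one₀ (by norm_num) (by norm_num) (by omega)
          linarith
      have := Real.logb_lt_logb (b := 2) (by norm_num)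
        (x := 1 + (1 / 2) ^ (i' + 1) + (1 / 2) ^ (i' + j' + 2))
        (y := 1 + (1 / 2) ^ (i + 1) + (1 / 2) ^ (i + j + 2)) (by positivity) (by linarith)
      exact sub_lt_sub_left this 2
  rwa [le_antisymm hle hge] at ho

lemma isStableDefect (hA : Admissible A) (hx : x ∈ defects A ∩ Set.Icc 0 2) :
    IsStableDefect A x := by
  obtain ⟨⟨n, hn, rfl⟩, -, hx2⟩ := hx
  exact ⟨n, hn, hA.isStable hn (hA.len_le_of_defect_le hn hx2), rfl⟩

lemma stableDefects_inter_Icc (hA : Admissible A) :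
    stableDefects A ∩ Set.Icc 0 2 = defects A ∩ Set.Icc 0 2 := by
  refine Set.Subset.antisymm ?_ fun x hx => ⟨hA.isStableDefect hx, hx.2⟩
  rintro x ⟨⟨n, hn, -, hx⟩, hx2⟩
  exact ⟨⟨n, hn, hx⟩, hx2⟩

end Admissible

end AdditionChain

theorem mainTheorem7 (A : Set AdditionChain) (hA : AdditionChain.Admissible A) :
    HasOrderType (AdditionChain.defects A ∩ Set.Icc 0 2) (ω ^ 2) ∧
    (∀ r : ℝ, r < 2 → ∃ o : Ordinal.{0},
      HasOrderType (AdditionChain.defects A ∩ Set.Icc 0 r) o ∧ o < ω ^ 2) ∧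
    (∀ α ∈ AdditionChain.defects A ∩ Set.Icc 0 2, AdditionChain.IsStableDefect A α) ∧
    HasOrderType (AdditionChain.stableDefects A ∩ Set.Icc 0 2) (ω ^ 2) :=
  ⟨hA.hasOrderType_defects, fun _ hr => hA.exists_hasOrderType_lt hr,
    fun _ hα => hA.isStableDefect hα, hA.stableDefects_inter_Icc ▸ hA.hasOrderType_defects⟩
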